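/- Call a compact convex set with non-empty interior a convex body. For a convex body $K\subset\mathbb{R}^{n+1}$ and a Lebesgue measurable set $E\subset K$ let $$P_K(E)=\sup\Big\{\int_E \operatorname{div}\xi\,dx : \xi \text{ a smooth vector field with compact support in } \operatorname{int}K,\ |\xi|\le 1\Big\}$$ be the perimeter of $E$ in the interior of $K$, let $|E|$ be the volume (Lebesgue measure) of $E$, and let $$I_K(v)=\inf\{P_K(E) : E\subset K \text{ measurable},\ |E|=v\}$$ be the isoperimetric profile of $K$. For $C\subset\mathbb{R}^{n+1}$, $x\in C$ and $r>0$ put $\overline{B}_C(x,r)=\overline{B}(x,r)\cap C$, where $\overline{B}(x,r)$ is the closed Euclidean ball. There is a universal constant $\ell_2>0$ such that the following holds. Let $C\subset\mathbb{R}^{n+1}$ be a convex body and let $r_0>0$. Then there exist constants $M>0$ and $\ell_1>0$, depending only on $r_0$ and $C$, such that $$I_{\overline{B}_C(x,r)}(v)\ \ge\ M\,\min\{v,\ |\overline{B}_C(x,r)|-v\}^{n/(n+1)}$$ for all $x\in C$, $0<r\le r_0$ and $0<v<|\overline{B}_C(x,r)|$, and moreover $$\ell_1 r^{n+1}\ \le\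 |\overline{B}_C(x,r)|\ \le\ \ell_2 r^{n+1}$$ for all $x\in C$ and $0<r\le r_0$. -/

import Mathlib

noncomputable section

namespace IsopConvex

open MeasureTheory
open scoped ENNReal ContDiff

/-- The Euclidean space `ℝ^d`. -/
abbrev Euc (d : ℕ) : Type := EuclideanSpace ℝ (Fin d)

/-- A convex body: a compact convex set with non-empty interior. -/
structure IsConvexBody {d : ℕ} (C : Set (Euc d)) : Prop where
  convex : Convex ℝ C
  isCompact : IsCompact C
  interior_nonempty : (interior C).Nonempty

/-- The divergence `∑ i, ∂ξ_i/∂x_i` of a vector field on `ℝ^d`. -/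
def divergence {d : ℕ} (ξ : Euc d → Euc d) (x : Euc d) : ℝ :=
  ∑ i : Fin d, (fderiv ℝ ξ x (EuclideanSpace.single i 1)) i

/-- Smooth vector fields with compact support in the open set `U` and pointwise norm at most `1`. -/
structure IsTestField {d : ℕ} (U : Set (Euc d)) (ξ : Euc d → Euc d) : Prop where
  contDiff : ContDiff ℝ ∞ ξ
  hasCompactSupport : HasCompactSupport ξ
  tsupport_subset : tsupport ξ ⊆ U
  norm_le_one : ∀ x, ‖ξ x‖ ≤ 1

/-- The perimeter of `E` relative to the interior of `C`. The supremum may be infinite. As `ξ = 0`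
is admissible, truncating the integrals at `0` does not change it. -/
def perimeter {d : ℕ} (C E : Set (Euc d)) : ℝ≥0∞ :=
  ⨆ (ξ : Euc d → Euc d) (_ : IsTestField (interior C) ξ),
    ENNReal.ofReal (∫ x in E, divergence ξ x)

/-- The isoperimetric profile `I_C(v)`: the infimum of the relative perimeters of the
(Lebesgue measurable) subsets of `C` of volume `v`. -/
def profile {d : ℕ} (C : Set (Euc d)) (v : ℝ) : ℝ≥0∞ :=
  ⨅ (E : Set (Euc d)) (_ : E ⊆ C) (_ : NullMeasurableSet E volume)
    (_ : volume E = ENNReal.ofReal v), perimeter C E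

/-- The intersection of `C` with the closed ball of centre `x` and radius `r`. -/
def relBall {d : ℕ} (C : Set (Euc d)) (x : Euc d) (r : ℝ) : Set (Euc d) :=
  Metric.closedBall x r ∩ C

end IsopConvex

end

noncomputable section

namespace IsopConvex

open MeasureTheory Set Metric Filter Topology
open scoped ENNReal ContDiff

/-! ### Smoothness of integrals depending on a parameter -/

section ParametricIntegral

variable {X P F : Type} [NormedAddCommGroup X] [NormedSpace ℝ X] [FiniteDimensional ℝ X]
  [NormedAddCommGroup P] [NormedSpace ℝ P] [MeasurableSpace P] [BorelSpace P]
  [SecondCountableTopology P]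
  {μ : Measure P} [IsFiniteMeasureOnCompacts μ]

/-! The lower bound is a relative isoperimetric inequality on a convex set `K`, whose constant
depends, besides `n`, only on a number `κ` with `|K ∩ B(y,s)| ≥ κ s^(n+1)` for `y ∈ K` and all
scales `s` up to the size of `K`.

Local step (`measureReal_mul_le_perimeter`): on a convex set of diameter at most `D`, the perimeter
controls `|L ∩ E| |L \ E| / (D |L|)`. Since the perimeter is a supremum over fields, one good field
suffices. For bumps `φ`, `ψ` approximating the indicators of `L \ E` and `L ∩ E`, a field with
divergence `(∫φ)ψ - (∫ψ)φ` transports one mass to the other along segments, which stay in `L` by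
convexity. Transport along whole segments has a singular kernel. Instead each mass is moved only to
the midpoints: both transports produce the same midpoint density, which cancels in the difference
(`divergence_sub_transportField`), and the kernel stays bounded.

Global step (`le_profile`): let `A` be the smaller of `K ∩ E` and `K \ E`. Almost every point of `A`
has a scale `s` at which `A` fills a nontrivial but not too large part of the ball, so the local
step gives perimeter at least a constant times `s^n` there. A Vitali family of disjoint such balls,
additivity of perimeter over them and subadditivity of `t ↦ t^(n/(n+1))` give the power law.

Uniformity: shrinking `C` towards one of its points puts a ball of comparable radius in every
`relBall C x r` (`closedBall_subset_relBall`). Applied first to `C` and then to `relBall C x r`,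
this gives a `κ` independent of `x` and `r`. -/

theorem hasFDerivAt_setIntegral_of_contDiff [NormedAddCommGroup F] [NormedSpace ℝ F]
    {k : Set P} (hk : IsCompact k) {G : X × P → F} (hG : ContDiff ℝ 1 G) (z : X) :
    HasFDerivAt (fun z => ∫ p in k, G (z, p) ∂μ)
      (∫ p in k, (fderiv ℝ G (z, p)).comp (ContinuousLinearMap.inl ℝ X P) ∂μ) z := by
  have hcont : Continuous fun q : X × P =>
      (fderiv ℝ G q).comp (ContinuousLinearMap.inl ℝ X P) :=
    (hG.continuous_fderiv one_ne_zero).clm_comp continuous_const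
  have : ProperSpace X := FiniteDimensional.proper ℝ X
  obtain ⟨b, hb⟩ := ((isCompact_closedBall z 1).prod hk).exists_bound_of_continuousOn
    hcont.continuousOn
  refine hasFDerivAt_integral_of_dominated_of_fderiv_le (μ := μ.restrict k) (bound := fun _ => b)
    (F := fun z p => G (z, p)) (s := closedBall z 1)
    (F' := fun z p => (fderiv ℝ G (z, p)).comp (ContinuousLinearMap.inl ℝ X P))
    (closedBall_mem_nhds z one_pos) ?_ ?_ ?_ ?_ ?_ ?_
  · exact .of_forall fun x =>
      ((hG.continuous.comp (by fun_prop : Continuous fun p : P => (x, p)))).aestronglyMeasurable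
  · exact ContinuousOn.integrableOn_compact hk
      (hG.continuous.comp (by fun_prop : Continuous fun p : P => (z, p))).continuousOn
  · exact (hcont.comp (by fun_prop : Continuous fun p : P => (z, p))).aestronglyMeasurable
  · filter_upwards [ae_restrict_mem hk.measurableSet] with p hp x hx using hb (x, p) ⟨hx, hp⟩
  · exact integrableOn_const hk.measure_lt_top.ne
  · refine .of_forall fun p x _ => ?_
    exact ((hG.differentiable one_ne_zero) (x, p)).hasFDerivAt.comp x
      (hasFDerivAt_prodMk_left x p)

/-- The derivative is an integral of the same kind with values in a space of linear maps, so the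
induction on the order must range over all targets `F`. -/
theorem contDiff_setIntegral_nat {k : Set P} (hk : IsCompact k) (m : ℕ) :
    ∀ {F : Type} [NormedAddCommGroup F] [NormedSpace ℝ F] {G : X × P → F}, ContDiff ℝ ∞ G →
      ContDiff ℝ m (fun z => ∫ p in k, G (z, p) ∂μ) := by
  induction m with
  | zero =>
    intro F _ _ G hG
    refine contDiff_zero.2 (continuous_iff_continuousAt.2 fun z => ?_)
    exact (hasFDerivAt_setIntegral_of_contDiff hk (hG.of_le (by simp)) z).continuousAt
  | succ m ih =>
    intro F _ _ G hG
    have hd := hasFDerivAt_setIntegral_of_contDiff (μ := μ) hk (hG.of_le (by simp))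
    rw [show ((m + 1 : ℕ) : WithTop ℕ∞) = (m : WithTop ℕ∞) + 1 by norm_cast,
      contDiff_succ_iff_fderiv]
    refine ⟨fun z => (hd z).differentiableAt, by simp, ?_⟩
    rw [show fderiv ℝ (fun z => ∫ p in k, G (z, p) ∂μ) = _ from funext fun z => (hd z).fderiv]
    exact ih (G := fun q => (fderiv ℝ G q).comp (ContinuousLinearMap.inl ℝ X P))
      ((hG.fderiv_right (by simp)).clm_comp contDiff_const)

theorem contDiff_setIntegral [NormedAddCommGroup F] [NormedSpace ℝ F]
    {k : Set P} (hk : IsCompact k) {G : X × P → F} (hG : ContDiff ℝ ∞ G) :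
    ContDiff ℝ ∞ (fun z => ∫ p in k, G (z, p) ∂μ) :=
  contDiff_infty.2 fun m => contDiff_setIntegral_nat hk m hG

end ParametricIntegral

/-! ### A field with divergence `(∫φ)ψ - (∫ψ)φ` -/

section TransportField

variable {n : ℕ}

/-- The trace of an endomorphism of `ℝ^d`, as a continuous linear functional. -/
def traceCLM (d : ℕ) : (Euc d →L[ℝ] Euc d) →L[ℝ] ℝ :=
  ∑ i : Fin d, (EuclideanSpace.proj i : Euc d →L[ℝ] ℝ).comp
    (ContinuousLinearMap.apply ℝ (Euc d) (EuclideanSpace.single i (1 : ℝ)))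

theorem traceCLM_apply {d : ℕ} (A : Euc d →L[ℝ] Euc d) :
    traceCLM d A = ∑ i, (A (EuclideanSpace.single i 1)) i := by
  simp [traceCLM]

theorem divergence_eq_traceCLM {d : ℕ} (ξ : Euc d → Euc d) (x : Euc d) :
    divergence ξ x = traceCLM d (fderiv ℝ ξ x) := by
  rw [traceCLM_apply, divergence]

theorem traceCLM_id {d : ℕ} : traceCLM d (ContinuousLinearMap.id ℝ (Euc d)) = d := by
  simp [traceCLM_apply]

theorem traceCLM_smulRight {d : ℕ} (f : Euc d →L[ℝ] ℝ) (v : Euc d) :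
    traceCLM d (f.smulRight v) = f v := by
  conv_rhs => rw [← (EuclideanSpace.basisFun (Fin d) ℝ).sum_repr v]
  simp [traceCLM_apply, mul_comm]

/-- The integrand of `transportField`, as a function of the point `z` and of the parameters. -/
def transportKernel (φ ψ : Euc (n + 1) → ℝ) (q : Euc (n + 1) × Euc (n + 1) × ℝ) : Euc (n + 1) :=
  (φ q.2.1 * (q.2.2 ^ n * ψ (q.2.1 + q.2.2 • (q.1 - q.2.1)))) • (q.1 - q.2.1)

/-- The average over `x`, with weight `φ`, of the fields that contract `ψ` halfway to `x`. -/
def transportField (φ ψ : Euc (n + 1) → ℝ) (z : Euc (n + 1)) : Euc (n + 1) :=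
  ∫ p in tsupport φ ×ˢ Icc (1 : ℝ) 2, transportKernel φ ψ (z, p)

variable {φ ψ : Euc (n + 1) → ℝ}

theorem contDiff_transportKernel (hφ : ContDiff ℝ ∞ φ) (hψ : ContDiff ℝ ∞ ψ) :
    ContDiff ℝ ∞ (transportKernel φ ψ) := by
  unfold transportKernel
  fun_prop

theorem contDiff_transportField (hφ : ContDiff ℝ ∞ φ) (hψ : ContDiff ℝ ∞ ψ)
    (hφc : HasCompactSupport φ) : ContDiff ℝ ∞ (transportField φ ψ) :=
  contDiff_setIntegral (IsCompact.prod hφc isCompact_Icc) (contDiff_transportKernel hφ hψ)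

theorem traceCLM_fderiv_transportKernel (hφ : ContDiff ℝ ∞ φ) (hψ : ContDiff ℝ ∞ ψ)
    (z x : Euc (n + 1)) (s : ℝ) :
    traceCLM (n + 1) ((fderiv ℝ (transportKernel φ ψ) (z, x, s)).comp
      (ContinuousLinearMap.inl ℝ _ _)) =
      φ x * ((n + 1 : ℝ) * s ^ n * ψ (x + s • (z - x)) +
        s ^ (n + 1) * fderiv ℝ ψ (x + s • (z - x)) (z - x)) := by
  have h1 : HasFDerivAt (fun z => transportKernel φ ψ (z, x, s))
      ((fderiv ℝ (transportKernel φ ψ) (z, x, s)).comp (ContinuousLinearMap.inl ℝ _ _)) z :=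
    HasFDerivAt.comp (g := transportKernel φ ψ) z
      ((contDiff_transportKernel hφ hψ).differentiable (by simp) (z, x, s)).hasFDerivAt
      (hasFDerivAt_prodMk_left z (x, s))
  have hw : HasFDerivAt (fun z : Euc (n + 1) => x + s • (z - x))
      (s • ContinuousLinearMap.id ℝ (Euc (n + 1))) z :=
    (((hasFDerivAt_id z).sub_const x).const_smul s).const_add x
  have hg := ((((hψ.differentiable (by simp)) (x + s • (z - x))).hasFDerivAt.comp z hw).const_mul
    (s ^ n)).const_mul (φ x)
  have h2 := hg.smul ((hasFDerivAt_id z).sub_const x)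
  rw [h1.unique h2, map_add, map_smul, traceCLM_id, traceCLM_smulRight]
  simp
  ring

theorem continuous_pow_mul_comp (hψ : ContDiff ℝ ∞ ψ) (z x : Euc (n + 1)) :
    Continuous fun s : ℝ => (n + 1 : ℝ) * s ^ n * ψ (x + s • (z - x)) +
        s ^ (n + 1) * fderiv ℝ ψ (x + s • (z - x)) (z - x) := by
  have := hψ.continuous
  have h2 : Continuous (fderiv ℝ ψ) := hψ.continuous_fderiv (by simp)
  fun_prop

/-- The weight `s ^ n` in the kernel makes the integrand the exact derivative of `s ^ (n + 1) * ψ (x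
+ s • (z - x))`. The endpoint `s = 1` returns `ψ z`, and `s = 2` gives the density of midpoints. -/
theorem integral_pow_mul_comp (hψ : ContDiff ℝ ∞ ψ) (z x : Euc (n + 1)) :
    ∫ s in Icc (1 : ℝ) 2, ((n + 1 : ℝ) * s ^ n * ψ (x + s • (z - x)) +
        s ^ (n + 1) * fderiv ℝ ψ (x + s • (z - x)) (z - x)) =
      2 ^ (n + 1) * ψ (x + (2 : ℝ) • (z - x)) - ψ z := by
  rw [integral_Icc_eq_integral_Ioc, ← intervalIntegral.integral_of_le one_le_two,
    intervalIntegral.integral_eq_sub_of_hasDerivAt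
      (f := fun s : ℝ => s ^ (n + 1) * ψ (x + s • (z - x)))]
  · simp
  · intro s _
    have hw : HasDerivAt (fun s : ℝ => x + s • (z - x)) (z - x) s := by
      simpa using ((hasDerivAt_id s).smul_const (z - x)).const_add x
    have h := (hasDerivAt_pow (n + 1) s).mul
      (((hψ.differentiable (by simp)) (x + s • (z - x))).hasFDerivAt.comp_hasDerivAt s hw)
    refine h.congr_deriv ?_
    simp
  · exact (continuous_pow_mul_comp hψ z x).intervalIntegrable _ _

theorem divergence_transportField (hφ : ContDiff ℝ ∞ φ) (hψ : ContDiff ℝ ∞ ψ)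
    (hφc : HasCompactSupport φ) (z : Euc (n + 1)) :
    divergence (transportField φ ψ) z =
      2 ^ (n + 1) * (∫ x, φ x * ψ (x + (2 : ℝ) • (z - x))) - (∫ x, φ x) * ψ z := by
  have hk : IsCompact (tsupport φ ×ˢ Icc (1 : ℝ) 2) := IsCompact.prod hφc isCompact_Icc
  have hK := contDiff_transportKernel hφ hψ
  have hcont : Continuous fun p : Euc (n + 1) × ℝ =>
      (fderiv ℝ (transportKernel φ ψ) (z, p)).comp (ContinuousLinearMap.inl ℝ _ _) :=
    ((hK.continuous_fderiv (by simp)).comp (by fun_prop)).clm_comp continuous_const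
  have hd := hasFDerivAt_setIntegral_of_contDiff (μ := volume) hk (hK.of_le (by simp)) z
  have hint := ContinuousOn.integrableOn_compact (μ := volume) hk hcont.continuousOn
  rw [divergence_eq_traceCLM, show fderiv ℝ (transportField φ ψ) z = _ from hd.fderiv,
    ← ContinuousLinearMap.integral_comp_comm _ hint, Measure.volume_eq_prod, setIntegral_prod]
  · simp only [traceCLM_fderiv_transportKernel hφ hψ, integral_const_mul,
      integral_pow_mul_comp hψ]
    have h1 : Integrable fun x => φ x * ψ (x + (2 : ℝ) • (z - x)) := by
      refine Continuous.integrable_of_hasCompactSupport ?_ hφc.mul_right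
      have := hψ.continuous
      have := hφ.continuous
      fun_prop
    have h2 : Integrable φ := hφ.continuous.integrable_of_hasCompactSupport hφc
    rw [setIntegral_eq_integral_of_forall_compl_eq_zero
      (fun x hx => by rw [image_eq_zero_of_notMem_tsupport hx, zero_mul]),
      ← integral_const_mul, ← integral_mul_const, ← integral_sub (h1.const_mul _) (h2.mul_const _)]
    congr 1 with x
    ring
  · exact ((traceCLM (n + 1)).continuous.comp hcont).continuousOn.integrableOn_compact hk

/-- Reflection in `z` preserves volume and swaps the two factors; this is the cancellation of the
midpoint densities. -/
theorem integral_mul_comp_reflection_comm (z : Euc (n + 1)) :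
    ∫ x, φ x * ψ (x + (2 : ℝ) • (z - x)) = ∫ x, ψ x * φ (x + (2 : ℝ) • (z - x)) := by
  rw [← integral_sub_left_eq_self (fun x => φ x * ψ (x + (2 : ℝ) • (z - x))) volume
    ((2 : ℝ) • z)]
  congr 1 with x
  rw [mul_comm]
  congr 2 <;> module

theorem divergence_sub_transportField (hφ : ContDiff ℝ ∞ φ) (hψ : ContDiff ℝ ∞ ψ)
    (hφc : HasCompactSupport φ) (hψc : HasCompactSupport ψ) (z : Euc (n + 1)) :
    divergence (transportField ψ φ - transportField φ ψ) z =
      (∫ x, φ x) * ψ z - (∫ x, ψ x) * φ z := by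
  have h1 := (contDiff_transportField hφ hψ hφc).differentiable (by simp) z
  have h2 := (contDiff_transportField hψ hφ hψc).differentiable (by simp) z
  rw [divergence_eq_traceCLM, fderiv_sub h2 h1, map_sub, ← divergence_eq_traceCLM,
    ← divergence_eq_traceCLM, divergence_transportField hφ hψ hφc,
    divergence_transportField hψ hφ hψc, integral_mul_comp_reflection_comm]
  ring

/-- Where the kernel is nonzero, `w = x + s • (z - x)` is in the support of `ψ`, and `z` divides the
segment from `x` to `w` at parameter `s⁻¹ ≤ 1`. -/
theorem mem_convexJoin_of_transportField_ne_zero {z : Euc (n + 1)}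
    (hz : transportField φ ψ z ≠ 0) : z ∈ convexJoin ℝ (tsupport φ) (tsupport ψ) := by
  by_contra hcon
  refine hz (setIntegral_eq_zero_of_forall_eq_zero ?_)
  rintro ⟨x, s⟩ ⟨hx, hs⟩
  have hs0 : 0 < s := one_pos.trans_le hs.1
  have hw : x + s • (z - x) ∉ tsupport ψ := by
    refine fun hw => hcon (mem_convexJoin.2 ⟨x, hx, _, hw, ?_⟩)
    rw [segment_eq_image']
    refine ⟨s⁻¹, ⟨by positivity, inv_le_one_of_one_le₀ hs.1⟩, ?_⟩
    simp only
    rw [add_sub_cancel_left, smul_smul, inv_mul_cancel₀ hs0.ne', one_smul, add_sub_cancel]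
  simp [transportKernel, image_eq_zero_of_notMem_tsupport hw]

theorem isCompact_convexJoin {d : ℕ} {s t : Set (Euc d)} (hs : IsCompact s) (ht : IsCompact t) :
    IsCompact (convexJoin ℝ s t) := by
  have h : convexJoin ℝ s t =
      (fun p : Euc d × Euc d × ℝ => p.1 + p.2.2 • (p.2.1 - p.1)) '' (s ×ˢ t ×ˢ Icc (0 : ℝ) 1) := by
    ext z
    simp only [mem_convexJoin, segment_eq_image', mem_image, Prod.exists, mem_prod]
    grind
  rw [h]
  exact (hs.prod (ht.prod isCompact_Icc)).image (by fun_prop)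

/-- As `1 ≤ s ≤ 2`, where the kernel is nonzero `‖z - x‖` is at most the distance of two points of
`L`, and `s ^ n ≤ 2 ^ n`. The interval of parameters `s` has length one. -/
theorem norm_transportField_le {D : ℝ} {L : Set (Euc (n + 1))} (hL : IsCompact L)
    (hD : ∀ x ∈ L, ∀ y ∈ L, ‖x - y‖ ≤ D) (hφL : tsupport φ ⊆ L) (hψL : tsupport ψ ⊆ L)
    (hφ1 : ∀ x, |φ x| ≤ 1) (hψ1 : ∀ x, |ψ x| ≤ 1) (z : Euc (n + 1)) :
    ‖transportField φ ψ z‖ ≤ 2 ^ n * D * volume.real L := by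
  have hmeas : volume (tsupport φ ×ˢ Icc (1 : ℝ) 2) ≤ volume L := by
    rw [Measure.volume_eq_prod, Measure.prod_prod, Real.volume_Icc]
    norm_num
    exact measure_mono hφL
  have hreal : volume.real (tsupport φ ×ˢ Icc (1 : ℝ) 2) ≤ volume.real L :=
    ENNReal.toReal_mono hL.measure_lt_top.ne hmeas
  rcases L.eq_empty_or_nonempty with rfl | ⟨x₀, hx₀⟩
  · simp [transportField, subset_empty_iff.1 hφL]
  have hD0 : 0 ≤ D := (norm_nonneg _).trans (hD x₀ hx₀ x₀ hx₀)
  refine (norm_setIntegral_le_of_norm_le_const (C := 2 ^ n * D)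
    (hmeas.trans_lt hL.measure_lt_top) ?_).trans
    (mul_le_mul_of_nonneg_left hreal (by positivity))
  rintro ⟨x, s⟩ ⟨hx, hs⟩
  have hs0 : 0 < s := one_pos.trans_le hs.1
  by_cases hw : x + s • (z - x) ∈ tsupport ψ
  · have h1 : ‖z - x‖ ≤ D := by
      have h := hD _ (hψL hw) _ (hφL hx)
      rw [add_sub_cancel_left, norm_smul, Real.norm_of_nonneg hs0.le] at h
      exact (le_mul_of_one_le_left (norm_nonneg _) hs.1).trans h
    have h2 : |s ^ n| ≤ 2 ^ n := by
      rw [abs_of_nonneg (by positivity)]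
      exact pow_le_pow_left₀ hs0.le hs.2 n
    have h3 : |φ x| * (|s ^ n| * |ψ (x + s • (z - x))|) ≤ 1 * (2 ^ n * 1) :=
      mul_le_mul (hφ1 x) (mul_le_mul h2 (hψ1 _) (abs_nonneg _) (by positivity))
        (by positivity) zero_le_one
    simp only [transportKernel, norm_smul, norm_mul, Real.norm_eq_abs]
    refine mul_le_mul (h3.trans_eq (by ring)) h1 (norm_nonneg _) (by positivity)
  · simp only [transportKernel, image_eq_zero_of_notMem_tsupport hw, mul_zero, zero_smul,
      norm_zero]
    positivity

end TransportField

/-! ### A Poincaré inequality for sets in convex bodies -/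

section Poincare

theorem exists_contDiff_eq_one_of_isCompact {d : ℕ} {F U : Set (Euc d)} (hF : IsCompact F)
    (hU : IsOpen U) (hFU : F ⊆ U) :
    ∃ φ : Euc d → ℝ, ContDiff ℝ ∞ φ ∧ HasCompactSupport φ ∧ tsupport φ ⊆ U ∧
      (∀ x, φ x ∈ Icc (0 : ℝ) 1) ∧ ∀ x ∈ F, φ x = 1 := by
  obtain ⟨k, hk, hFk, hkU⟩ := exists_compact_between hF hU hFU
  obtain ⟨φ, hφ, hr, hs, h1⟩ := exists_contMDiff_support_eq_eq_one_iff (n := ⊤)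
    (modelWithCornersSelf ℝ (Euc d)) isOpen_interior hF.isClosed hFk
  have hts : tsupport φ ⊆ k :=
    closure_minimal (hs.subset.trans interior_subset) hk.isClosed
  exact ⟨φ, hφ.contDiff, hk.of_isClosed_subset (isClosed_tsupport φ) hts, hts.trans hkU,
    fun x => hr (mem_range_self x), fun x hx => (h1 x).1 hx⟩

theorem exists_isCompact_subset_half {d : ℕ} {A : Set (Euc d)} (hA : NullMeasurableSet A)
    (hA' : volume A ≠ ⊤) :
    ∃ F ⊆ A, IsCompact F ∧ volume.real A / 2 ≤ volume.real F := by
  rcases eq_or_ne (volume A) 0 with h0 | h0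
  · exact ⟨∅, empty_subset _, isCompact_empty, by simp [Measure.real, h0]⟩
  obtain ⟨t, htA, ht, hte⟩ := hA.exists_measurable_subset_ae_eq
  rw [← measure_congr hte] at h0 hA'
  obtain ⟨F, hFt, hF, hlt⟩ := ht.exists_lt_isCompact_of_ne_top hA' (ENNReal.half_lt_self h0 hA')
  refine ⟨F, hFt.trans htA, hF, ?_⟩
  have := ENNReal.toReal_mono hF.measure_lt_top.ne hlt.le
  rw [ENNReal.toReal_div, measure_congr hte] at this
  simpa [Measure.real] using this

variable {n : ℕ} {L : Set (Euc (n + 1))} {D : ℝ}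

theorem isTestField_transportField {φ ψ : Euc (n + 1) → ℝ} {c : ℝ} (hLc : Convex ℝ L)
    (hL : IsCompact L) (hD : ∀ x ∈ L, ∀ y ∈ L, ‖x - y‖ ≤ D)
    (hφ : ContDiff ℝ ∞ φ) (hψ : ContDiff ℝ ∞ ψ)
    (hφc : HasCompactSupport φ) (hψc : HasCompactSupport ψ)
    (hφL : tsupport φ ⊆ interior L) (hψL : tsupport ψ ⊆ interior L)
    (hφ1 : ∀ x, |φ x| ≤ 1) (hψ1 : ∀ x, |ψ x| ≤ 1)
    (hc : 2 ^ (n + 1) * D * volume.real L ≤ c) (hc0 : 0 < c) :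
    IsTestField (interior L) (c⁻¹ • (transportField ψ φ - transportField φ ψ)) := by
  have hhull : IsCompact (convexJoin ℝ (tsupport φ) (tsupport ψ)) :=
    isCompact_convexJoin hφc hψc
  have hts : tsupport (c⁻¹ • (transportField ψ φ - transportField φ ψ)) ⊆
      convexJoin ℝ (tsupport φ) (tsupport ψ) := by
    refine closure_minimal (fun z hz => ?_) hhull.isClosed
    by_contra hcon
    have h1 : transportField φ ψ z = 0 :=
      not_not.1 fun h => hcon (mem_convexJoin_of_transportField_ne_zero h)
    have h2 : transportField ψ φ z = 0 :=
      not_not.1 fun h => hcon (convexJoin_comm (𝕜 := ℝ) (tsupport φ) (tsupport ψ) ▸ mem_convexJoin_of_transportField_ne_zero h)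
    exact hz (by simp [h1, h2])
  refine ⟨?_, hhull.of_isClosed_subset (isClosed_tsupport _) hts, hts.trans
    (convexJoin_subset hφL hψL hLc.interior), fun z => ?_⟩
  · exact contDiff_const.smul
      ((contDiff_transportField hψ hφ hψc).sub (contDiff_transportField hφ hψ hφc))
  · have h1 := norm_transportField_le hL hD (hφL.trans interior_subset)
      (hψL.trans interior_subset) hφ1 hψ1 z
    have h2 := norm_transportField_le hL hD (hψL.trans interior_subset)
      (hφL.trans interior_subset) hψ1 hφ1 z
    have h3 := norm_sub_le (transportField ψ φ z) (transportField φ ψ z)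
    rw [Pi.smul_apply, Pi.sub_apply, norm_smul, norm_inv, Real.norm_of_nonneg hc0.le,
      inv_mul_le_iff₀ hc0]
    rw [pow_succ] at hc
    linarith

theorem le_perimeter_of_contDiff {φ ψ : Euc (n + 1) → ℝ} {c : ℝ} (hLc : Convex ℝ L)
    (hL : IsCompact L) (hD : ∀ x ∈ L, ∀ y ∈ L, ‖x - y‖ ≤ D) (E : Set (Euc (n + 1)))
    (hφ : ContDiff ℝ ∞ φ) (hψ : ContDiff ℝ ∞ ψ)
    (hφc : HasCompactSupport φ) (hψc : HasCompactSupport ψ)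
    (hφL : tsupport φ ⊆ interior L) (hψL : tsupport ψ ⊆ interior L)
    (hφ1 : ∀ x, |φ x| ≤ 1) (hψ1 : ∀ x, |ψ x| ≤ 1)
    (hc : 2 ^ (n + 1) * D * volume.real L ≤ c) (hc0 : 0 < c) :
    ENNReal.ofReal (((∫ x, φ x) * (∫ x in E, ψ x) - (∫ x, ψ x) * ∫ x in E, φ x) / c) ≤
      perimeter L E := by
  refine le_trans (le_of_eq ?_) (le_iSup₂_of_le _ (isTestField_transportField hLc hL hD hφ hψ
    hφc hψc hφL hψL hφ1 hψ1 hc hc0) le_rfl)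
  congr 1
  have hdiv : ∀ z, divergence (c⁻¹ • (transportField ψ φ - transportField φ ψ)) z =
      c⁻¹ * ((∫ x, φ x) * ψ z - (∫ x, ψ x) * φ z) := fun z => by
    have hd : DifferentiableAt ℝ (transportField ψ φ - transportField φ ψ) z :=
      ((contDiff_transportField hψ hφ hψc).sub
        (contDiff_transportField hφ hψ hφc)).differentiable (by simp) z
    rw [divergence_eq_traceCLM, fderiv_const_smul hd, map_smul, ← divergence_eq_traceCLM,
      divergence_sub_transportField hφ hψ hφc hψc, smul_eq_mul]
  have h1 : IntegrableOn φ E := (hφ.continuous.integrable_of_hasCompactSupport hφc).integrableOn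
  have h2 : IntegrableOn ψ E := (hψ.continuous.integrable_of_hasCompactSupport hψc).integrableOn
  simp only [hdiv]
  rw [integral_const_mul, integral_sub (h2.const_mul _) (h1.const_mul _), integral_const_mul,
    integral_const_mul, div_eq_inv_mul]

theorem measureReal_le_integral {d : ℕ} {φ : Euc d → ℝ} {F : Set (Euc d)} {μ : Measure (Euc d)}
    (hF : MeasurableSet F) (hF' : μ F ≠ ⊤) (hφ : Integrable φ μ) (h0 : ∀ x, 0 ≤ φ x)
    (h1 : ∀ x ∈ F, φ x = 1) : μ.real F ≤ ∫ x, φ x ∂μ := by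
  rw [← integral_indicator_one hF]
  refine integral_mono ((integrable_indicator_iff hF).2 (integrableOn_const hF')) hφ fun x => ?_
  by_cases hx : x ∈ F
  · simp [hx, h1 x hx]
  · simp [hx, h0 x]

theorem integral_le_measureReal {d : ℕ} {φ : Euc d → ℝ} {U : Set (Euc d)} {μ : Measure (Euc d)}
    (hU : MeasurableSet U) (hU' : μ U ≠ ⊤) (hφ : Integrable φ μ) (h1 : ∀ x, φ x ≤ 1)
    (h0 : tsupport φ ⊆ U) : ∫ x, φ x ∂μ ≤ μ.real U := by
  rw [← integral_indicator_one hU]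
  refine integral_mono hφ ((integrable_indicator_iff hU).2 (integrableOn_const hU')) fun x => ?_
  by_cases hx : x ∈ U
  · simp [hx, h1 x]
  · simp [hx, image_eq_zero_of_notMem_tsupport fun h => hx (h0 h)]

/-- A Poincaré inequality for characteristic functions on convex sets of diameter at most `D`. -/
theorem measureReal_mul_le_perimeter (hLc : Convex ℝ L) (hL : IsCompact L) (hD0 : 0 < D)
    (hD : ∀ x ∈ L, ∀ y ∈ L, ‖x - y‖ ≤ D) {E : Set (Euc (n + 1))} (hE : NullMeasurableSet E) :
    ENNReal.ofReal (volume.real (L ∩ E) * volume.real (L \ E) /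
      (8 * (2 ^ (n + 1) * D * volume.real L))) ≤ perimeter L E := by
  have hLfin : volume L ≠ ⊤ := hL.measure_lt_top.ne
  -- The boundary of a convex set is null, so the compact approximations can be taken inside the
  -- interior, where test fields live.
  have hae : (interior L : Set _) =ᵐ[volume] L :=
    interior_ae_eq_of_null_frontier (hLc.addHaar_frontier volume)
  have ha : volume.real (interior L ∩ E) = volume.real (L ∩ E) :=
    measureReal_congr (hae.inter (ae_eq_refl E))
  have hb : volume.real (interior L \ E) = volume.real (L \ E) :=
    measureReal_congr (hae.diff (ae_eq_refl E))
  set a := volume.real (L ∩ E)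
  set b := volume.real (L \ E)
  set V := volume.real L
  have ha0 : 0 ≤ a := measureReal_nonneg
  have hb0 : 0 ≤ b := measureReal_nonneg
  rcases (mul_nonneg ha0 hb0).eq_or_lt with h0 | hab
  · simp [← h0]
  have hV : 0 < V := (pos_of_mul_pos_left hab hb0).trans_le
    (measureReal_mono inter_subset_left hLfin)
  have hfin : ∀ s ⊆ L, volume s ≠ ⊤ := fun s hs => ((measure_mono (μ := volume) hs).trans_lt hL.measure_lt_top).ne
  have hI : MeasurableSet (interior L) := isOpen_interior.measurableSet
  obtain ⟨F, hFE, hF, hFa⟩ := exists_isCompact_subset_half (hI.nullMeasurableSet.inter hE)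
    (hfin _ (inter_subset_left.trans interior_subset))
  obtain ⟨F', hFE', hF', hFb⟩ := exists_isCompact_subset_half (hI.nullMeasurableSet.diff hE)
    (hfin _ (sdiff_subset.trans interior_subset))
  rw [ha] at hFa
  rw [hb] at hFb
  -- The main term is at least `a * b / 4`; this `ε` makes the error `V * ε` half of that.
  set ε := a * b / (8 * V) with hε
  have hε0 : 0 < ε := by positivity
  obtain ⟨U, hFU, hU, hUlt⟩ := F'.exists_isOpen_lt_add (μ := volume) hF'.measure_lt_top.ne
    (ENNReal.ofReal_pos.2 hε0).ne'
  have hUfin : volume U ≠ ⊤ := (hUlt.trans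
    (ENNReal.add_lt_top.2 ⟨hF'.measure_lt_top, ENNReal.ofReal_lt_top⟩)).ne
  have hUdiff : volume.real (U \ F') ≤ ε := by
    rw [measureReal_sdiff hFU hF'.measurableSet hUfin, sub_le_iff_le_add']
    have := ENNReal.toReal_mono (ENNReal.add_lt_top.2
      ⟨hF'.measure_lt_top, ENNReal.ofReal_lt_top⟩).ne hUlt.le
    rwa [ENNReal.toReal_add hF'.measure_lt_top.ne ENNReal.ofReal_ne_top,
      ENNReal.toReal_ofReal hε0.le] at this
  obtain ⟨ψ, hψ, hψc, hψL, hψr, hψF⟩ := exists_contDiff_eq_one_of_isCompact hF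
    isOpen_interior (hFE.trans inter_subset_left)
  -- Only `φ` needs a tight support: `U ∩ E ⊆ U \ F'` bounds its mass in `E` by `ε`. For `ψ` the
  -- crude bound `∫ ψ ≤ V` is enough.
  obtain ⟨φ, hφ, hφc, hφL, hφr, hφF⟩ := exists_contDiff_eq_one_of_isCompact hF'
    (hU.inter isOpen_interior) (subset_inter hFU (hFE'.trans sdiff_subset))
  have hφi := hφ.continuous.integrable_of_hasCompactSupport (μ := volume) hφc
  have hψi := hψ.continuous.integrable_of_hasCompactSupport (μ := volume) hψc
  have habs : ∀ {f : Euc (n + 1) → ℝ}, (∀ x, f x ∈ Icc (0 : ℝ) 1) → ∀ x, |f x| ≤ 1 :=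
    fun h x => abs_le.2 ⟨by linarith [(h x).1], (h x).2⟩
  have hc0 : 0 < 2 ^ (n + 1) * D * V := by positivity
  refine le_trans (ENNReal.ofReal_le_ofReal ?_) (le_perimeter_of_contDiff hLc hL hD E hφ hψ
    hφc hψc (hφL.trans inter_subset_right) hψL (habs hφr) (habs hψr) le_rfl hc0)
  rw [← div_div, div_le_div_iff_of_pos_right hc0]
  have i1 : b / 2 ≤ ∫ x, φ x := hFb.trans (measureReal_le_integral hF'.measurableSet
    hF'.measure_lt_top.ne hφi (fun x => (hφr x).1) hφF)
  have i2 : a / 2 ≤ ∫ x in E, ψ x := by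
    refine hFa.trans (le_trans (le_of_eq ?_) (measureReal_le_integral hF.measurableSet
      ((Measure.restrict_apply_le _ _).trans_lt hF.measure_lt_top).ne hψi.integrableOn
      (fun x => (hψr x).1) hψF))
    rw [measureReal_restrict_apply hF.measurableSet,
      inter_eq_left.2 (hFE.trans inter_subset_right)]
  have i3 : ∫ x, ψ x ≤ V := integral_le_measureReal hL.measurableSet hLfin hψi
    (fun x => (hψr x).2) (hψL.trans interior_subset)
  have i4 : ∫ x in E, φ x ≤ ε := by
    refine (integral_le_measureReal hU.measurableSet
      ((Measure.restrict_apply_le _ _).trans_lt hUfin.lt_top).ne hφi.integrableOn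
      (fun x => (hφr x).2) (hφL.trans inter_subset_left)).trans (le_trans ?_ hUdiff)
    rw [measureReal_restrict_apply hU.measurableSet]
    exact measureReal_mono (fun x hx => ⟨hx.1, fun h => (hFE' h).2 hx.2⟩)
      (measure_ne_top_of_subset sdiff_subset hUfin)
  have i5 : 0 ≤ ∫ x in E, φ x := integral_nonneg fun x => (hφr x).1
  have j1 : b / 2 * (a / 2) ≤ (∫ x, φ x) * ∫ x in E, ψ x :=
    mul_le_mul i1 i2 (by positivity) ((by positivity : 0 ≤ b / 2).trans i1)
  have j2 : (∫ x, ψ x) * ∫ x in E, φ x ≤ V * ε := mul_le_mul i3 i4 i5 hV.le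
  have j3 : V * ε = a * b / 8 := by rw [hε]; field_simp
  linarith

end Poincare

/-! ### Superadditivity of the perimeter over disjoint sets -/

section Superadditivity

/-- The perimeter of `E` in the open set `U`. -/
def perimeterOn {d : ℕ} (U E : Set (Euc d)) : ℝ≥0∞ :=
  ⨆ (ξ : Euc d → Euc d) (_ : IsTestField U ξ), ENNReal.ofReal (∫ x in E, divergence ξ x)

variable {d : ℕ} {U V E : Set (Euc d)}

theorem IsTestField.zero : IsTestField U (0 : Euc d → Euc d) :=
  ⟨contDiff_const, .zero, by simp [tsupport], by simp⟩

theorem IsTestField.mono {ξ : Euc d → Euc d} (h : IsTestField U ξ) (hUV : U ⊆ V) :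
    IsTestField V ξ :=
  ⟨h.1, h.2, h.3.trans hUV, h.4⟩

theorem perimeterOn_mono (hUV : U ⊆ V) : perimeterOn U E ≤ perimeterOn V E :=
  iSup₂_le fun ξ hξ => le_iSup₂_of_le ξ (hξ.mono hUV) le_rfl

theorem IsTestField.integrable_divergence {ξ : Euc d → Euc d} (h : IsTestField U ξ) :
    Integrable (divergence ξ) := by
  have h1 : divergence ξ = traceCLM d ∘ fderiv ℝ ξ := funext (divergence_eq_traceCLM ξ)
  rw [h1]
  exact ((traceCLM d).continuous.comp
    (h.contDiff.continuous_fderiv (by simp))).integrable_of_hasCompactSupport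
    ((h.hasCompactSupport.fderiv ℝ).comp_left (map_zero _))

/-- At each point at most one of the fields is nonzero, so the norm bound survives addition. -/
theorem IsTestField.add {ξ η : Euc d → Euc d} (hξ : IsTestField U ξ) (hη : IsTestField V η)
    (hUV : Disjoint U V) : IsTestField (U ∪ V) (ξ + η) := by
  refine ⟨hξ.1.add hη.1, hξ.2.add hη.2,
    (tsupport_add ξ η).trans (union_subset_union hξ.3 hη.3), fun x => ?_⟩
  by_cases hx : x ∈ tsupport ξ
  · have : x ∉ tsupport η := fun h => hUV.le_bot ⟨hξ.3 hx, hη.3 h⟩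
    simpa [image_eq_zero_of_notMem_tsupport this] using hξ.4 x
  · simpa [image_eq_zero_of_notMem_tsupport hx] using hη.4 x

theorem perimeterOn_add_le (hUV : Disjoint U V) :
    perimeterOn U E + perimeterOn V E ≤ perimeterOn (U ∪ V) E := by
  refine ENNReal.biSup_add_biSup_le' ⟨_, IsTestField.zero⟩ ⟨_, IsTestField.zero⟩
    fun ξ hξ η hη => ?_
  rcases le_total (∫ x in E, divergence ξ x) 0 with h1 | h1
  · rw [ENNReal.ofReal_of_nonpos h1, zero_add]
    exact le_iSup₂_of_le η (hη.mono subset_union_right) le_rfl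
  rcases le_total (∫ x in E, divergence η x) 0 with h2 | h2
  · rw [ENNReal.ofReal_of_nonpos h2, add_zero]
    exact le_iSup₂_of_le ξ (hξ.mono subset_union_left) le_rfl
  refine le_iSup₂_of_le (ξ + η) (hξ.add hη hUV) (le_of_eq ?_)
  rw [← ENNReal.ofReal_add h1 h2, ← integral_add hξ.integrable_divergence.integrableOn
    hη.integrable_divergence.integrableOn]
  congr 2 with x
  rw [divergence_eq_traceCLM, divergence_eq_traceCLM, divergence_eq_traceCLM,
    fderiv_add (hξ.1.differentiable (by simp) x) (hη.1.differentiable (by simp) x), map_add]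

theorem sum_perimeterOn_le {ι : Type*} (s : Finset ι) (W : ι → Set (Euc d))
    (hW : (s : Set ι).PairwiseDisjoint W) :
    ∑ i ∈ s, perimeterOn (W i) E ≤ perimeterOn (⋃ i ∈ s, W i) E := by
  classical
  induction s using Finset.induction_on with
  | empty => simp
  | insert i s hi ih =>
    rw [Finset.sum_insert hi, Finset.set_biUnion_insert]
    refine (add_le_add_right (ih (hW.subset (by simp))) _).trans (perimeterOn_add_le ?_)
    refine disjoint_iUnion₂_right.2 fun j hj => hW (by simp) (by simp [hj]) ?_
    rintro rfl
    exact hi hj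

theorem sum_perimeter_le {ι : Type*} (s : Finset ι) (W : ι → Set (Euc d)) {K : Set (Euc d)}
    (hW : (s : Set ι).PairwiseDisjoint W) (hK : ∀ i ∈ s, W i ⊆ K) :
    ∑ i ∈ s, perimeter (W i) E ≤ perimeter K E :=
  (sum_perimeterOn_le s (fun i => interior (W i))
    (hW.mono fun _ => interior_subset)).trans
    (perimeterOn_mono (iUnion₂_subset fun i hi => interior_mono (hK i hi)))

end Superadditivity

/-! ### Balls of intermediate density and a Vitali covering -/

section Covering

variable {d : ℕ} {K A : Set (Euc d)} {ρ κ : ℝ}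

/-- At almost every point of `A` there is a scale at which `A` fills at most half of `K`, while
at half that scale it fills at least half of `K`. -/
theorem ae_exists_radius (hK : IsCompact K) (hρ : 0 < ρ)
    (hKρ : ∀ x ∈ K, K ⊆ closedBall x ρ)
    (hκ : ∀ x ∈ K, ∀ s, 0 < s → s ≤ ρ → κ * s ^ d ≤ volume.real (relBall K x s))
    (hAK : A ⊆ K) (hA : 2 * volume.real A ≤ volume.real K) :
    ∀ᵐ x ∂volume.restrict A, x ∈ K → ∃ s, 0 < s ∧ s ≤ ρ ∧
      2 * volume.real (closedBall x s ∩ A) ≤ volume.real (relBall K x s) ∧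
      κ * (s / 2) ^ d ≤ 2 * volume.real (closedBall x s ∩ A) := by
  filter_upwards [Besicovitch.ae_tendsto_measure_inter_div volume A] with x hx hxK
  have hfin : ∀ s ⊆ K, volume s ≠ ⊤ := fun s hs => measure_ne_top_of_subset hs hK.measure_lt_top.ne
  have hr0 : ∀ k : ℕ, 0 < ρ / 2 ^ k := fun k => by positivity
  have hlim : Tendsto (fun k : ℕ => ρ / 2 ^ k) atTop (𝓝[>] 0) := by
    refine tendsto_nhdsWithin_iff.2 ⟨?_, .of_forall hr0⟩
    have := (tendsto_pow_atTop_nhds_zero_of_lt_one (r := (1 / 2 : ℝ)) (by norm_num)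
      (by norm_num)).const_mul ρ
    simpa [div_eq_mul_inv] using this
  -- At a density point `A` eventually fills more than half of the full ball, hence of `relBall K
  -- x`.
  have hex : ∃ k : ℕ, volume.real (relBall K x (ρ / 2 ^ k)) <
      2 * volume.real (closedBall x (ρ / 2 ^ k) ∩ A) := by
    obtain ⟨k, hk⟩ := ((hx.comp hlim).eventually
      (lt_mem_nhds (by norm_num : (1 / 2 : ℝ≥0∞) < 1))).exists
    refine ⟨k, ?_⟩
    simp only [Function.comp] at hk
    have hBfin : volume (closedBall x (ρ / 2 ^ k)) ≠ ⊤ := measure_closedBall_lt_top.ne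
    have hB0 : volume (closedBall x (ρ / 2 ^ k)) ≠ 0 :=
      (measure_closedBall_pos volume x (hr0 k)).ne'
    rw [ENNReal.lt_div_iff_mul_lt (Or.inl hB0) (Or.inl hBfin), inter_comm] at hk
    have h1 := (ENNReal.toReal_lt_toReal (ENNReal.mul_ne_top (by simp) hBfin)
      (hfin _ (inter_subset_right.trans hAK))).2 hk
    rw [ENNReal.toReal_mul] at h1
    have h2 : volume.real (relBall K x (ρ / 2 ^ k)) ≤ volume.real (closedBall x (ρ / 2 ^ k)) :=
      measureReal_mono inter_subset_left hBfin
    simp only [Measure.real] at h2 ⊢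
    norm_num at h1
    linarith
  classical
  obtain ⟨k, hk, hmin⟩ := (⟨Nat.find hex, Nat.find_spec hex, fun m hm => Nat.find_min hex hm⟩ :
    ∃ k : ℕ, volume.real (relBall K x (ρ / 2 ^ k)) <
      2 * volume.real (closedBall x (ρ / 2 ^ k) ∩ A) ∧ ∀ m < k, ¬ (volume.real
      (relBall K x (ρ / 2 ^ m)) < 2 * volume.real (closedBall x (ρ / 2 ^ m) ∩ A)))
  -- The first such scale is not `ρ` itself, where the ball contains all of `K`. The radius one
  -- dyadic step before it is the one sought.
  rcases k with _ | j
  · exfalso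
    have h1 : relBall K x (ρ / 2 ^ 0) = K := inter_eq_right.2 (by simpa using hKρ x hxK)
    have h2 : volume.real (closedBall x (ρ / 2 ^ 0) ∩ A) ≤ volume.real A :=
      measureReal_mono inter_subset_right (hfin _ hAK)
    rw [h1] at hk
    linarith
  have hle : ρ / 2 ^ j ≤ ρ := div_le_self hρ.le (one_le_pow₀ one_le_two)
  have hhalf : ρ / 2 ^ (j + 1) = ρ / 2 ^ j / 2 := by rw [pow_succ, div_div]
  refine ⟨ρ / 2 ^ j, hr0 j, hle, not_lt.1 (hmin j (Nat.lt_succ_self j)), ?_⟩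
  rw [hhalf] at hk
  have h1 := hκ x hxK (ρ / 2 ^ j / 2) (half_pos (hr0 j)) ((half_le_self (hr0 j).le).trans hle)
  have h2 : volume.real (closedBall x (ρ / 2 ^ j / 2) ∩ A) ≤
      volume.real (closedBall x (ρ / 2 ^ j) ∩ A) :=
    measureReal_mono (inter_subset_inter_left _
      (closedBall_subset_closedBall (half_le_self (hr0 j).le)))
      (hfin _ (inter_subset_right.trans hAK))
  linarith

theorem exists_finset_closedBall_cover (hK : IsCompact K) (hρ : 0 < ρ)
    (hKρ : ∀ x ∈ K, K ⊆ closedBall x ρ)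
    (hκ : ∀ x ∈ K, ∀ s, 0 < s → s ≤ ρ → κ * s ^ d ≤ volume.real (relBall K x s))
    (hAK : A ⊆ K) (hA : 2 * volume.real A ≤ volume.real K) (hA0 : 0 < volume.real A) :
    ∃ (t : Finset (Euc d)) (s : Euc d → ℝ),
      (∀ x ∈ t, x ∈ K ∧ 0 < s x ∧
        2 * volume.real (closedBall x (s x) ∩ A) ≤ volume.real (relBall K x (s x)) ∧
        κ * (s x / 2) ^ d ≤ 2 * volume.real (closedBall x (s x) ∩ A)) ∧
      ((t : Set (Euc d)).PairwiseDisjoint fun x => closedBall x (s x)) ∧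
      volume.real A ≤ 2 * (volume.real (closedBall (0 : Euc d) 1) * 5 ^ d) * ∑ x ∈ t, s x ^ d := by
  have hAfin : volume A ≠ ⊤ := measure_ne_top_of_subset hAK hK.measure_lt_top.ne
  set Q : Euc d → ℝ → Prop := fun x s => 0 < s ∧ s ≤ ρ ∧
      2 * volume.real (closedBall x s ∩ A) ≤ volume.real (relBall K x s) ∧
      κ * (s / 2) ^ d ≤ 2 * volume.real (closedBall x s ∩ A) with hQ
  set G : Set (Euc d) := {x | x ∈ K ∧ ∃ s, Q x s} with hG
  have hGA : volume A ≤ volume G := by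
    have hae : ∀ᵐ x ∂volume.restrict A, x ∈ K → ∃ s, Q x s :=
      ae_exists_radius hK hρ hKρ hκ hAK hA
    have h0 := ae_iff.1 hae
    have hsub : A ⊆ G ∪ ({x | ¬ (x ∈ K → ∃ s, Q x s)} ∩ A) := fun x hx => by
      by_cases h : ∃ s, Q x s
      · exact Or.inl ⟨hAK hx, h⟩
      · exact Or.inr ⟨fun h' => h (h' (hAK hx)), hx⟩
    refine (measure_mono hsub).trans ((measure_union_le _ _).trans ?_)
    have h1 : volume ({x | ¬ (x ∈ K → ∃ s, Q x s)} ∩ A) = 0 :=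
      le_antisymm ((Measure.le_restrict_apply _ _).trans h0.le) bot_le
    rw [h1, add_zero]
  have hch : ∀ x : Euc d, ∃ s, x ∈ G → Q x s := fun x => by
    by_cases hx : x ∈ G
    · exact ⟨hx.2.choose, fun _ => hx.2.choose_spec⟩
    · exact ⟨0, fun h => absurd h hx⟩
  choose s hs using hch
  obtain ⟨u, huG, hdisj, hcov⟩ := Vitali.exists_disjoint_subfamily_covering_enlargement_closedBall
    G id s ρ (fun x hx => (hs x hx).2.1) 5 (by norm_num)
  simp only [id] at hdisj hcov
  have hucount : u.Countable := hdisj.countable_of_nonempty_interior fun x hx =>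
    ⟨x, ball_subset_interior_closedBall (mem_ball_self (hs x (huG hx)).1)⟩
  have hGsub : G ⊆ ⋃ x ∈ u, closedBall x (5 * s x) := fun x hx => by
    obtain ⟨b, hb, hsub⟩ := hcov x hx
    exact mem_biUnion hb (hsub (mem_closedBall_self (hs x hx).1.le))
  set w := volume.real (closedBall (0 : Euc d) 1) with hw
  have hvol : ∀ x ∈ u, volume (closedBall x (5 * s x)) = ENNReal.ofReal (w * 5 ^ d * s x ^ d) :=
    fun x hx => by
    have h0 := (hs x (huG hx)).1
    have h := Measure.addHaar_real_closedBall' (volume : Measure (Euc d)) x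
      (r := 5 * s x) (by positivity)
    rw [finrank_euclideanSpace_fin, ← hw] at h
    rw [← ENNReal.ofReal_toReal (measure_closedBall_lt_top (x := x) (r := 5 * s x)).ne,
      ← Measure.real, h]
    congr 1
    ring
  have hle : volume A ≤ ∑' x : u, ENNReal.ofReal (w * 5 ^ d * s x ^ d) := by
    refine hGA.trans ((measure_mono hGsub).trans ((measure_biUnion_le volume hucount _).trans
      (le_of_eq ?_)))
    exact tsum_congr fun x => hvol x x.2
  -- Giving up half of `|A|` makes the inequality strict, so a finite partial sum already satisfies
  -- it; hence the factor `2` in the conclusion.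
  have hlt : volume A / 2 < ∑' x : u, ENNReal.ofReal (w * 5 ^ d * s x ^ d) :=
    (ENNReal.half_lt_self (fun h => by simp [Measure.real, h] at hA0) hAfin).trans_le hle
  rw [ENNReal.tsum_eq_iSup_sum] at hlt
  obtain ⟨t, ht⟩ := lt_iSup_iff.1 hlt
  refine ⟨t.map (Function.Embedding.subtype _), s, ?_, ?_, ?_⟩
  · intro x hx
    obtain ⟨y, -, rfl⟩ := Finset.mem_map.1 hx
    have h := hs y (huG y.2)
    exact ⟨(huG y.2).1, h.1, h.2.2⟩
  · refine hdisj.subset fun x hx => ?_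
    obtain ⟨y, -, rfl⟩ := Finset.mem_map.1 (Finset.mem_coe.1 hx)
    exact y.2
  · rw [← ENNReal.ofReal_sum_of_nonneg fun x _ => by
      have := (hs x (huG x.2)).1; positivity] at ht
    have h := ENNReal.toReal_mono ENNReal.ofReal_ne_top ht.le
    rw [ENNReal.toReal_ofReal (Finset.sum_nonneg fun x _ => by
      have := (hs x (huG x.2)).1; positivity), ENNReal.toReal_div, ← Finset.mul_sum] at h
    rw [Finset.sum_map]
    simp only [Function.Embedding.subtype_apply, Measure.real]
    norm_num at h
    linarith

end Covering

/-! ### The isoperimetric inequality on a convex set -/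

section Isoperimetric

variable {n : ℕ}

/-- Powers with exponent in `[0, 1]` are subadditive. The empty sum must be excluded because `0 ^ 0
= 1` when `n = 0`. -/
theorem rpow_sum_pow_le {ι : Type*} {t : Finset ι} (ht : t.Nonempty) {s : ι → ℝ}
    (hs : ∀ i ∈ t, 0 ≤ s i) :
    (∑ i ∈ t, s i ^ (n + 1)) ^ ((n : ℝ) / (n + 1)) ≤ ∑ i ∈ t, s i ^ n := by
  have h1 : ∀ x : ℝ, 0 ≤ x → (x ^ (n + 1)) ^ ((n : ℝ) / (n + 1)) = x ^ n := fun x hx => by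
    rw [← Real.rpow_natCast, ← Real.rpow_mul hx, ← Real.rpow_natCast]
    congr 1
    push_cast
    field_simp
  induction ht using Finset.Nonempty.cons_induction with
  | singleton a => simp [h1 (s a) (hs a (by simp))]
  | cons a t ha ht ih =>
    rw [Finset.sum_cons, Finset.sum_cons]
    have hs' : ∀ i ∈ t, 0 ≤ s i := fun i hi => hs i (by simp [hi])
    have ha0 := hs a (by simp)
    refine (Real.rpow_add_le_add_rpow (by positivity) (Finset.sum_nonneg fun i hi => by
      have := hs' i hi; positivity) (by positivity) ?_).trans ?_
    · exact div_le_one_of_le₀ (by linarith) (by positivity)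
    · rw [h1 _ ha0]
      exact add_le_add_right (ih hs') _

theorem convex_relBall {d : ℕ} {K : Set (Euc d)} (hK : Convex ℝ K) (x : Euc d) (r : ℝ) :
    Convex ℝ (relBall K x r) :=
  (convex_closedBall x r).inter hK

theorem isCompact_relBall {d : ℕ} {K : Set (Euc d)} (hK : IsCompact K) (x : Euc d) (r : ℝ) :
    IsCompact (relBall K x r) :=
  (isCompact_closedBall x r).inter hK

variable {K A E : Set (Euc (n + 1))} {ρ κ : ℝ}

theorem le_perimeter_relBall (hKc : Convex ℝ K) (hK : IsCompact K) (hE : NullMeasurableSet E)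
    (hA : A = K ∩ E ∨ A = K \ E) {x : Euc (n + 1)} {s : ℝ} (hs : 0 < s) (hκ0 : 0 < κ)
    (h1 : 2 * volume.real (closedBall x s ∩ A) ≤ volume.real (relBall K x s))
    (h2 : κ * (s / 2) ^ (n + 1) ≤ 2 * volume.real (closedBall x s ∩ A)) :
    ENNReal.ofReal (κ / (64 * 4 ^ (n + 1)) * s ^ n) ≤ perimeter (relBall K x s) E := by
  have hL := isCompact_relBall hK x s
  have hadd : volume.real (relBall K x s ∩ E) + volume.real (relBall K x s \ E) =
      volume.real (relBall K x s) :=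
    measureReal_inter_add_sdiff₀ hE hL.measure_lt_top.ne
  set m := volume.real (closedBall x s ∩ A)
  set V := volume.real (relBall K x s)
  -- The Poincaré bound is symmetric in `E` and its complement, so both choices of `A` are treated
  -- alike.
  have hprod : volume.real (relBall K x s ∩ E) * volume.real (relBall K x s \ E) = m * (V - m) := by
    rcases hA with hA | hA
    · have : m = volume.real (relBall K x s ∩ E) := by
        simp only [m, hA, relBall, inter_assoc]
      rw [this, ← hadd]; ring
    · have : m = volume.real (relBall K x s \ E) := by
        simp only [m, hA, relBall, inter_sdiff_assoc]
      rw [this, ← hadd]; ring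
  have hm : 0 < m := by
    have : 0 < κ * (s / 2) ^ (n + 1) := by positivity
    linarith
  have hV : 0 < V := by linarith
  refine le_trans (ENNReal.ofReal_le_ofReal ?_) (measureReal_mul_le_perimeter (D := 2 * s)
    (convex_relBall hKc x s) hL (by positivity) (fun y hy z hz => ?_) hE)
  · rw [hprod, le_div_iff₀ (by positivity)]
    have e : κ / (64 * 4 ^ (n + 1)) * s ^ n * (8 * (2 ^ (n + 1) * (2 * s) * V)) =
        κ * (s / 2) ^ (n + 1) * V / 4 := by
      rw [show (4 : ℝ) = 2 * 2 by norm_num, mul_pow, div_pow]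
      field_simp
      ring
    rw [e]
    have e1 : κ * (s / 2) ^ (n + 1) * V ≤ 2 * m * V := mul_le_mul_of_nonneg_right h2 hV.le
    have e2 : m * (V / 2) ≤ m * (V - m) := mul_le_mul_of_nonneg_left (by linarith) hm.le
    linarith
  · have hy' := mem_closedBall_iff_norm.1 hy.1
    have hz' := mem_closedBall_iff_norm'.1 hz.1
    have := norm_add_le (y - x) (x - z)
    rw [sub_add_sub_cancel] at this
    linarith

theorem le_perimeter_of_measure_le_half (hKc : Convex ℝ K) (hK : IsCompact K) (hρ : 0 < ρ)
    (hκ0 : 0 < κ) (hKρ : ∀ x ∈ K, K ⊆ closedBall x ρ)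
    (hκ : ∀ x ∈ K, ∀ s, 0 < s → s ≤ ρ → κ * s ^ (n + 1) ≤ volume.real (relBall K x s))
    (hE : NullMeasurableSet E) (hAE : A = K ∩ E ∨ A = K \ E)
    (hA : 2 * volume.real A ≤ volume.real K) (hA0 : 0 < volume.real A) :
    ENNReal.ofReal (κ / (64 * 4 ^ (n + 1)) * (volume.real A / (2 *
      (volume.real (closedBall (0 : Euc (n + 1)) 1) * 5 ^ (n + 1)))) ^ ((n : ℝ) / (n + 1))) ≤
      perimeter K E := by
  have hAK : A ⊆ K := by
    rcases hAE with rfl | rfl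
    exacts [inter_subset_left, sdiff_subset]
  obtain ⟨t, s, ht, hdisj, hle⟩ := exists_finset_closedBall_cover hK hρ hKρ hκ hAK hA hA0
  set w := volume.real (closedBall (0 : Euc (n + 1)) 1) with hw
  have hw0 : 0 < w := ENNReal.toReal_pos (measure_closedBall_pos volume _ one_pos).ne'
    measure_closedBall_lt_top.ne
  have htne : t.Nonempty := by
    rw [Finset.nonempty_iff_ne_empty]
    rintro rfl
    simp at hle
    linarith
  refine le_trans (ENNReal.ofReal_le_ofReal (q := ∑ x ∈ t, κ / (64 * 4 ^ (n + 1)) * s x ^ n) ?_) ?_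
  · rw [← Finset.mul_sum]
    refine mul_le_mul_of_nonneg_left (le_trans ?_ (rpow_sum_pow_le htne fun x hx =>
      (ht x hx).2.1.le)) (by positivity)
    refine Real.rpow_le_rpow (by positivity) ?_ (by positivity)
    rw [div_le_iff₀ (by positivity)]
    linarith
  · rw [ENNReal.ofReal_sum_of_nonneg fun x hx => by have := (ht x hx).2.1; positivity]
    refine (Finset.sum_le_sum fun x hx => ?_).trans
      (sum_perimeter_le t (fun x => relBall K x (s x))
        (hdisj.mono fun _ => inter_subset_left) fun _ _ => inter_subset_right)
    obtain ⟨-, h0, h1, h2⟩ := ht x hx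
    exact le_perimeter_relBall hKc hK hE hAE h0 hκ0 h1 h2

theorem le_profile (hKc : Convex ℝ K) (hK : IsCompact K) (hρ : 0 < ρ)
    (hκ0 : 0 < κ) (hKρ : ∀ x ∈ K, K ⊆ closedBall x ρ)
    (hκ : ∀ x ∈ K, ∀ s, 0 < s → s ≤ ρ → κ * s ^ (n + 1) ≤ volume.real (relBall K x s))
    {v : ℝ} (hv : 0 < v) (hvK : v < volume.real K) :
    ENNReal.ofReal (κ / (64 * 4 ^ (n + 1)) / (2 *
      (volume.real (closedBall (0 : Euc (n + 1)) 1) * 5 ^ (n + 1))) ^ ((n : ℝ) / (n + 1)) *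
      (min v (volume.real K - v)) ^ ((n : ℝ) / (n + 1))) ≤ profile K v := by
  refine le_iInf fun E => le_iInf fun hEK => le_iInf fun hE => le_iInf fun hvE => ?_
  have hvr : volume.real (K ∩ E) = v := by
    rw [inter_eq_right.2 hEK, Measure.real, hvE, ENNReal.toReal_ofReal hv.le]
  have hadd : volume.real (K ∩ E) + volume.real (K \ E) = volume.real K :=
    measureReal_inter_add_sdiff₀ hE hK.measure_lt_top.ne
  obtain ⟨A, hAE, hAm⟩ : ∃ A, (A = K ∩ E ∨ A = K \ E) ∧
      volume.real A = min v (volume.real K - v) := by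
    rcases min_choice v (volume.real K - v) with h | h
    · exact ⟨_, Or.inl rfl, by rw [h, hvr]⟩
    · exact ⟨_, Or.inr rfl, by rw [h]; linarith⟩
  have h0 : 0 < volume.real A := by
    rw [hAm]
    exact lt_min hv (by linarith)
  have h2 : 2 * volume.real A ≤ volume.real K := by
    rw [hAm]
    linarith [min_le_left v (volume.real K - v), min_le_right v (volume.real K - v)]
  refine le_trans (le_of_eq ?_)
    (le_perimeter_of_measure_le_half hKc hK hρ hκ0 hKρ hκ hE hAE h2 h0)
  rw [← hAm, Real.div_rpow measureReal_nonneg (by positivity)]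
  congr 1
  ring

end Isoperimetric

/-! ### Volume bounds for balls and relative balls -/

section Volume

/-- The volume of the Euclidean unit ball is bounded independently of the dimension. -/
theorem exists_volume_unitBall_le :
    ∃ c : ℝ, 0 < c ∧ ∀ n : ℕ, volume.real (closedBall (0 : Euc (n + 1)) 1) ≤ c := by
  set f : ℕ → ℝ := fun d => √Real.pi ^ d / Real.Gamma (d / 2 + 1) with hf
  have hpos : ∀ d, 0 < f d := fun d => by
    have : 0 < Real.Gamma ((d : ℝ) / 2 + 1) := Real.Gamma_pos_of_pos (by positivity)
    have := Real.pi_pos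
    positivity
  have hstep : ∀ d, f (d + 2) = Real.pi / ((d : ℝ) / 2 + 1) * f d := fun d => by
    have h1 : ((d + 2 : ℕ) : ℝ) / 2 + 1 = ((d : ℝ) / 2 + 1) + 1 := by push_cast; ring
    have h2 : (d : ℝ) / 2 + 1 ≠ 0 := by positivity
    simp only [hf]
    rw [h1, Real.Gamma_add_one h2, pow_add, Real.sq_sqrt Real.pi_pos.le]
    field_simp
  -- From `d = 5` on, `d / 2 + 1 ≥ 3.5 > π`, so steps of two no longer increase `f`; the values
  -- below `7` dominate the rest.
  have hle : ∀ d, f d ≤ ∑ i ∈ Finset.range 7, f i := by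
    intro d
    induction d using Nat.strong_induction_on with
    | _ d ih =>
      rcases lt_or_ge d 7 with hd | hd
      · exact Finset.single_le_sum (fun i _ => (hpos i).le) (Finset.mem_range.2 hd)
      · obtain ⟨e, rfl⟩ : ∃ e, d = e + 2 := ⟨d - 2, by omega⟩
        refine le_trans ?_ (ih e (by omega))
        have he : (5 : ℝ) ≤ e := by exact_mod_cast (by omega : 5 ≤ e)
        rw [hstep]
        refine mul_le_of_le_one_left (hpos e).le (div_le_one_of_le₀ ?_ (by positivity))
        linarith [Real.pi_lt_d2]
  refine ⟨_, (hpos 0).trans_le (hle 0), fun n => ?_⟩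
  have h := EuclideanSpace.volume_closedBall (Fin (n + 1)) (0 : Euc (n + 1)) 1
  rw [Fintype.card_fin, ENNReal.ofReal_one, one_pow, one_mul] at h
  rw [Measure.real, h, ENNReal.toReal_ofReal (hpos (n + 1)).le]
  exact hle (n + 1)

variable {d : ℕ} {C : Set (Euc d)} {p y : Euc d} {δ R s : ℝ}

/-- The homothety with centre `y` and ratio `s / R ≤ 1` maps `C` into itself by convexity and into
the ball of radius `s`; the ball on the left is the image of `closedBall p δ`. -/
theorem closedBall_subset_relBall (hC : Convex ℝ C) (hp : closedBall p δ ⊆ C) (hy : y ∈ C)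
    (hR : C ⊆ closedBall y R) (hs : 0 < s) (hsR : s ≤ R) :
    closedBall (y + (s / R) • (p - y)) (δ / R * s) ⊆ relBall C y s := by
  have hR0 : 0 < R := hs.trans_le hsR
  have hτ : 0 < s / R := div_pos hs hR0
  intro q hq
  set p' := y + (s / R)⁻¹ • (q - y) with hp'
  have hq' : q = y + (s / R) • (p' - y) := by
    rw [hp', add_sub_cancel_left, smul_smul, mul_inv_cancel₀ hτ.ne', one_smul, add_sub_cancel]
  have hpC : p' ∈ C := by
    refine hp (mem_closedBall_iff_norm.2 ?_)
    rw [mem_closedBall_iff_norm, hq', add_sub_add_left_eq_sub, ← smul_sub, norm_smul,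
      sub_sub_sub_cancel_right, Real.norm_of_nonneg hτ.le] at hq
    rw [show δ / R * s = s / R * δ by ring] at hq
    exact le_of_mul_le_mul_left hq hτ
  refine ⟨mem_closedBall_iff_norm.2 ?_, ?_⟩
  · have h := mem_closedBall_iff_norm.1 (hR hpC)
    rw [hq', add_sub_cancel_left, norm_smul, Real.norm_of_nonneg hτ.le]
    calc s / R * ‖p' - y‖ ≤ s / R * R := by gcongr
      _ = s := div_mul_cancel₀ s hR0.ne'
  · rw [hq']
    exact hC.add_smul_sub_mem hy hpC ⟨hτ.le, (div_le_one hR0).2 hsR⟩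

theorem le_volume_relBall (hC : Convex ℝ C) (hp : closedBall p δ ⊆ C) (hδ : 0 < δ) (hy : y ∈ C)
    (hR : C ⊆ closedBall y R) (hs : 0 < s) (hsR : s ≤ R) :
    volume.real (closedBall (0 : Euc d) 1) * (δ / R) ^ d * s ^ d ≤ volume.real (relBall C y s) := by
  have hR0 : 0 < R := hs.trans_le hsR
  have h := measureReal_mono (μ := volume) (closedBall_subset_relBall hC hp hy hR hs hsR)
    (measure_ne_top_of_subset inter_subset_left measure_closedBall_lt_top.ne)
  rw [Measure.addHaar_real_closedBall' _ _ (by positivity), finrank_euclideanSpace_fin,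
    mul_pow] at h
  linarith

theorem volume_relBall_le (hs : 0 ≤ s) :
    volume.real (relBall C y s) ≤ volume.real (closedBall (0 : Euc d) 1) * s ^ d := by
  have h := measureReal_mono (μ := volume) (inter_subset_left (s := closedBall y s) (t := C))
    measure_closedBall_lt_top.ne
  rw [Measure.addHaar_real_closedBall' _ _ hs, finrank_euclideanSpace_fin] at h
  exact h.trans_eq (mul_comm _ _)

/-- A convex body contains a ball, and lies in a ball of radius `R ≥ r₀` around each point. -/
theorem IsConvexBody.exists_radii (hC : IsConvexBody C) (r₀ : ℝ) :
    ∃ (p : Euc d) (δ R : ℝ), 0 < δ ∧ r₀ ≤ R ∧ closedBall p δ ⊆ C ∧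
      ∀ y ∈ C, C ⊆ closedBall y R := by
  obtain ⟨p, hp⟩ := hC.interior_nonempty
  obtain ⟨δ, hδ, hδC⟩ := nhds_basis_closedBall.mem_iff.1 (mem_interior_iff_mem_nhds.1 hp)
  refine ⟨p, δ, max r₀ (diam C), hδ, le_max_left _ _, hδC, fun y hy z hz => ?_⟩
  exact (dist_le_diam_of_mem hC.isCompact.isBounded hz hy).trans (le_max_right _ _)

end Volume

end IsopConvex

end

/-! ### Choice of the constants -/

theorem theorem4p12 :
    ∃ ℓ₂ : ℝ, 0 < ℓ₂ ∧
      ∀ (n : ℕ) (C : Set (IsopConvex.Euc (n + 1))), IsopConvex.IsConvexBody C →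
        ∀ r₀ : ℝ, 0 < r₀ →
          ∃ M ℓ₁ : ℝ, 0 < M ∧ 0 < ℓ₁ ∧
            (∀ x ∈ C, ∀ r : ℝ, 0 < r → r ≤ r₀ →
              ∀ v : ℝ, 0 < v →
                v < MeasureTheory.volume.real (IsopConvex.relBall C x r) →
                ENNReal.ofReal
                    (M * (min v (MeasureTheory.volume.real (IsopConvex.relBall C x r) - v)) ^
                      ((n : ℝ) / ((n : ℝ) + 1))) ≤
                  IsopConvex.profile (IsopConvex.relBall C x r) v) ∧
            (∀ x ∈ C, ∀ r : ℝ, 0 < r → r ≤ r₀ →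
              ℓ₁ * r ^ (n + 1) ≤ MeasureTheory.volume.real (IsopConvex.relBall C x r) ∧
              MeasureTheory.volume.real (IsopConvex.relBall C x r) ≤ ℓ₂ * r ^ (n + 1)) := by
  open IsopConvex MeasureTheory Metric in
  obtain ⟨c, hc0, hc⟩ := exists_volume_unitBall_le
  refine ⟨c, hc0, fun n C hC r₀ hr₀ => ?_⟩
  obtain ⟨p, δ, R, hδ, hR, hp, hCR⟩ := hC.exists_radii r₀
  have hR0 : 0 < R := hr₀.trans_le hR
  set w := volume.real (closedBall (0 : Euc (n + 1)) 1) with hw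
  have hw0 : 0 < w := ENNReal.toReal_pos (measure_closedBall_pos volume _ one_pos).ne'
    measure_closedBall_lt_top.ne
  have hθ : 0 < δ / R := div_pos hδ hR0
  -- `relBall C x r` contains a ball of radius `δ / R * r` and lies within `2 * r` of each of its
  -- points; the ratio `δ / R / 2` of these radii depends on neither `x` nor `r`.
  set κ := w * (δ / R / 2) ^ (n + 1) with hκ
  have hκ0 : 0 < κ := by positivity
  refine ⟨κ / (64 * 4 ^ (n + 1)) / (2 * (w * 5 ^ (n + 1))) ^ ((n : ℝ) / (n + 1)),
    w * (δ / R) ^ (n + 1), by positivity, by positivity, ?_, ?_⟩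
  · intro x hx r hr hrr v hv hvK
    have hball := closedBall_subset_relBall hC.convex hp hx (hCR x hx) hr (hrr.trans hR)
    have hKc := convex_relBall hC.convex x r
    have h2r : ∀ y ∈ relBall C x r, relBall C x r ⊆ closedBall y (2 * r) := fun y hy z hz => by
      have h1 := mem_closedBall.1 hz.1
      have h2 := mem_closedBall'.1 hy.1
      exact mem_closedBall.2 ((dist_triangle z x y).trans (by linarith))
    refine le_profile hKc (isCompact_relBall hC.isCompact x r) (ρ := 2 * r) (by positivity) hκ0
      h2r (fun y hy s hs hsr => ?_) hv hvK
    have h := le_volume_relBall hKc hball (by positivity) hy (h2r y hy) hs hsr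
    rwa [show δ / R * r / (2 * r) = δ / R / 2 by field_simp] at h
  · intro x hx r hr hrr
    refine ⟨le_volume_relBall hC.convex hp hδ hx (hCR x hx) hr (hrr.trans hR),
      (volume_relBall_le hr.le).trans ?_⟩
    exact mul_le_mul_of_nonneg_right (hc n) (by positivity)
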